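/- Let $X$ be a uniform space (for instance a metric space) and let $f : X \to X$ be continuous. The topological entropy of $f$ is taken in Bowen's sense, $h(f) = \sup_{K} h(f,K)$ over all compact $K \subset X$, where $h(f,K)$ is the supremum over all entourages $U$ (in a metric space: over all $\varepsilon > 0$) of the exponential growth rate $$\limsup_{m\to\infty} \tfrac1m \ln N_m(K,U),$$ with $N_m(K,U)$ the least number of sets $\{y : (f^k(c), f^k(y)) \in U,\ 0 \le k < m\}$, $c \in X$, that cover $K$; if $X$ is compact, then $h(f) = h(f,X)$ is the usual topological entropy. Let $A$ be an $n \times n$ matrix with entries in $\{0,1\}$, and let $$\Sigma_A = \{x \in \{1,\dots,n\}^{\mathbb Z} : A(x_{k+1},x_k) = 1 \text{ for all } k \in \mathbb Z\},$$ with the topology induced by the product of the discrete topologies, and $\sigma : \Sigma_A \to \Sigma_A$, $(\sigma x)_k = x_{k+1}$, the shift map. Let $S \subset X$ be a compact set with $f(S) \subset S$, and suppose that there exists a continuous surjective map $\pi : S \to \Sigma_A$ satisfying $\sigma \circ \pi = \pi \circ f|_S$. Then $$h(f) \;\ge\; \ln\bigl(\max\{|\lambda| : \lambda \in \mathbb C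 \text{ is an eigenvalue of } A\}\bigr),$$ with the conventions that $\ln 0 = -\infty$, that the maximum is $0$ when $n=0$, and that $h(f)$ takes values in $[-\infty,+\infty]$. -/

import Mathlib

/-- The space `Σ_A` of bi-infinite sequences `x : ℤ → {1, …, n}` that are admissible for the
transition matrix `A`, i.e. `A (x (k + 1)) (x k) = 1` for all `k`. Its topology is the one induced
by the product topology on `ℤ → Fin n`, where `Fin n` is discrete. -/
def AdmissibleSeq {n : ℕ} (A : Matrix (Fin n) (Fin n) ℂ) : Set (ℤ → Fin n) :=
  {x | ∀ k : ℤ, A (x (k + 1)) (x k) = 1}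

/-- The shift map `σ : Σ_A → Σ_A`, `(σ x) k = x (k + 1)`. -/
def shiftMap {n : ℕ} (A : Matrix (Fin n) (Fin n) ℂ) (x : AdmissibleSeq A) : AdmissibleSeq A :=
  ⟨fun k => x.1 (k + 1), fun k => x.2 (k + 1)⟩

/-- Bowen's topological entropy of a self-map of a uniform (for instance metric) space: the
supremum over all compact sets `K` of the exponential growth rate, in the limit of small entourages
(small `ε`), of the least number of dynamical balls of length `m` that cover `K`. -/
noncomputable def topologicalEntropy {X : Type*} [UniformSpace X] (f : X → X) : EReal :=
  ⨆ (K : Set X) (_ : IsCompact K), Dynamics.coverEntropy f K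

/-- On a compact space the supremum is attained at the whole space. -/
theorem topologicalEntropy_eq_of_compactSpace {X : Type*} [UniformSpace X] [CompactSpace X]
    (f : X → X) : topologicalEntropy f = Dynamics.coverEntropy f Set.univ :=
  le_antisymm
    (iSup₂_le fun K _ => Dynamics.coverEntropy_monotone f (Set.subset_univ K))
    (le_iSup₂_of_le Set.univ isCompact_univ le_rfl)

/-!
Let `u` be a left eigenvector of `A` for an eigenvalue `μ ≠ 0`, and call a symbol `a` *charged* if
`u a ≠ 0`. The eigenvalue equation `μ * u a = ∑ u b`, summed over the successors `b` of `a`, shows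
that every charged symbol has a charged successor, and, iterated, that the number of paths of
charged symbols with `m` steps starting at `a` is at least a constant times `‖μ‖ ^ m`. All these
paths extend forwards for ever; if `a` is moreover the end of an infinite backward path of charged
symbols, they extend to points of `Σ_A`. Such an `a` exists, since a relation on a finite set in
which every element has a successor is not well-founded.

Distinct words need distinct dynamical balls at the scale of the partition of `S` by the symbol at
time `0`, and that scale is an entourage because `S` is compact.
-/

open Dynamics ExpGrowth Filter Function Set Uniformity
open scoped ENNReal NNReal Matrix

lemma log_le_expGrowthSup_of_pow_mul_le {N : ℕ → ℝ≥0∞} {r c C : ℝ≥0} (hc : c ≠ 0)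
    (h : ∀ m, (r : ℝ≥0∞) ^ m * c ≤ C * N (m + 1)) : ENNReal.log r ≤ expGrowthSup N := by
  rw [← expGrowthSup_pow]
  refine expGrowthSup_le_of_eventually_le (b := (r * (c⁻¹ * C) : ℝ≥0)) ENNReal.coe_ne_top
    (eventually_atTop.2 ⟨1, fun m hm => ?_⟩)
  obtain ⟨k, rfl⟩ := Nat.exists_eq_add_of_le' hm
  have hcc : (c : ℝ≥0∞) * (c⁻¹ : ℝ≥0) = 1 := by exact_mod_cast mul_inv_cancel₀ hc
  calc (r : ℝ≥0∞) ^ (k + 1)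
      = r * (c⁻¹ : ℝ≥0) * (r ^ k * c) := by
        rw [mul_mul_mul_comm, mul_comm _ (c : ℝ≥0∞), hcc, mul_one, pow_succ']
    _ ≤ r * (c⁻¹ : ℝ≥0) * (C * N (k + 1)) := mul_le_mul_right (h k) _
    _ = (r * (c⁻¹ * C) : ℝ≥0) * N (k + 1) := by push_cast; ring

section Paths

variable {α : Type*} {R : α → α → Prop}

lemma exists_backward_path [Finite α] [Nonempty α] (hR : ∀ a, ∃ b, R a b) :
    ∃ g : ℕ → α, ∀ k, R (g (k + 1)) (g k) := by
  suffices h : ¬ WellFounded R by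
    rw [wellFounded_iff_isEmpty_descending_chain, not_isEmpty_iff] at h
    exact ⟨h.some.1, h.some.2⟩
  intro hwf
  have : Std.Irrefl (Relation.TransGen R) := ⟨hwf.transGen.irrefl.irrefl⟩
  have hswap : WellFounded (swap (Relation.TransGen R)) := Finite.wellFounded_of_trans_of_irrefl _
  obtain ⟨a, -, hmax⟩ := hswap.has_min univ univ_nonempty
  obtain ⟨b, hab⟩ := hR a
  exact hmax b (mem_univ b) (.single hab)

lemma exists_int_path_of_nat_paths {x g : ℕ → α} (hx : ∀ k, R (x k) (x (k + 1)))
    (hg : ∀ k, R (g (k + 1)) (g k)) (h : x 0 = g 0) :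
    ∃ y : ℤ → α, (∀ k : ℕ, y k = x k) ∧ ∀ z, R (y z) (y (z + 1)) := by
  refine ⟨fun z => z.rec x fun k => g (k + 1), fun k => rfl, fun z => ?_⟩
  match z with
  | .ofNat k => exact hx k
  | .negSucc 0 => exact (congrArg (R (g 1)) h).mpr (hg 0)
  | .negSucc (k + 1) => exact hg (k + 1)

lemma exists_nat_path_of_fin_path (hR : ∀ a, ∃ b, R a b) {m : ℕ} {w : Fin (m + 1) → α}
    (hw : ∀ t : Fin m, R (w t.castSucc) (w t.succ)) :
    ∃ x : ℕ → α, (∀ t : Fin (m + 1), x t = w t) ∧ ∀ k, R (x k) (x (k + 1)) := by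
  choose next hnext using hR
  refine ⟨fun k => next^[k - m] (w ⟨min k m, by lia⟩), fun t => ?_, fun k => ?_⟩
  · simp [Nat.sub_eq_zero_of_le t.is_le, t.is_le]
  · rcases lt_or_ge k m with hk | hk
    · simpa [Nat.sub_eq_zero_of_le hk.le, Nat.sub_eq_zero_of_le hk, hk.le, Nat.succ_le_of_lt hk]
        using hw ⟨k, hk⟩
    · simpa [Nat.succ_sub hk, iterate_succ_apply', hk, hk.trans k.le_succ] using hnext _

variable [Fintype α]

open Classical in
/-- The paths of the relation `R` with `m` steps that start at `a`, encoded as the sequences of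
their `m + 1` vertices. -/
noncomputable def pathsFrom (R : α → α → Prop) (m : ℕ) (a : α) : Finset (Fin (m + 1) → α) :=
  {w | w 0 = a ∧ ∀ t : Fin m, R (w t.castSucc) (w t.succ)}

lemma mem_pathsFrom {m : ℕ} {a : α} {w : Fin (m + 1) → α} :
    w ∈ pathsFrom R m a ↔ w 0 = a ∧ ∀ t : Fin m, R (w t.castSucc) (w t.succ) := by
  simp [pathsFrom]

lemma card_pathsFrom_zero (a : α) : (pathsFrom R 0 a).card = 1 :=
  Finset.card_eq_one.2 ⟨fun _ => a, by ext w; simp [mem_pathsFrom, funext_iff]⟩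

open Classical in
lemma sum_card_pathsFrom_le (m : ℕ) (a : α) :
    ∑ b with R a b, (pathsFrom R m b).card ≤ (pathsFrom R (m + 1) a).card := by
  rw [← Finset.card_biUnion fun b _ b' _ hb => Finset.disjoint_left.2 fun w hw hw' =>
    hb ((mem_pathsFrom.1 hw).1.symm.trans (mem_pathsFrom.1 hw').1)]
  refine Finset.card_le_card_of_injOn (Fin.cons (α := fun _ => α) a) (fun w hw => ?_)
    (Fin.cons_right_injective (α := fun _ => α) a).injOn
  obtain ⟨b, hb, hwb⟩ := Finset.mem_biUnion.1 hw
  obtain ⟨rfl, hw⟩ := mem_pathsFrom.1 hwb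
  refine mem_pathsFrom.2 ⟨rfl, Fin.cases ?_ fun t => ?_⟩
  · simpa using hb
  · simpa [← Fin.succ_castSucc] using hw t

open Classical in
lemma pow_mul_le_card_pathsFrom {c : α → ℝ≥0} {r C : ℝ≥0}
    (hc : ∀ a, r * c a ≤ ∑ b with R a b, c b) (hC : ∀ a, c a ≤ C) (m : ℕ) (a : α) :
    r ^ m * c a ≤ C * (pathsFrom R m a).card := by
  induction m generalizing a with
  | zero => simpa [card_pathsFrom_zero] using hC a
  | succ m ih =>
    calc r ^ (m + 1) * c a
        = r ^ m * (r * c a) := by ring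
      _ ≤ r ^ m * ∑ b with R a b, c b := by gcongr; exact hc a
      _ = ∑ b with R a b, r ^ m * c b := Finset.mul_sum ..
      _ ≤ ∑ b with R a b, C * ((pathsFrom R m b).card : ℝ≥0) :=
          Finset.sum_le_sum fun b _ => ih b
      _ = C * (∑ b with R a b, (pathsFrom R m b).card : ℕ) := by
          push_cast; exact (Finset.mul_sum ..).symm
      _ ≤ C * (pathsFrom R (m + 1) a).card := by gcongr; exact sum_card_pathsFrom_le m a

end Paths

section Coding

variable {Y α : Type*}

/-- The partition of `Y` into the fibres of `φ`, as a relation; `φ` is thought of as assigning to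
each point a symbol, and the relation serves as the scale at which entropy is measured. -/
def fiberRel (φ : Y → α) : SetRel Y Y :=
  {p | φ p.1 = φ p.2}

lemma fiberRel_mem_uniformity [UniformSpace Y] [CompactSpace Y] [TopologicalSpace α]
    [DiscreteTopology α] {φ : Y → α} (hφ : Continuous φ) : fiberRel φ ∈ 𝓤 Y := by
  have hopen : IsOpen (fiberRel φ) :=
    (isOpen_discrete (diagonal α)).preimage (hφ.prodMap hφ)
  rw [← nhdsSet_diagonal_eq_uniformity]
  exact hopen.mem_nhdsSet.2 fun p hp => congrArg φ hp

lemma card_le_coverMincard_fiberRel {T : Y → Y} {F : Set Y} {φ : Y → α} {m : ℕ}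
    {P : Finset (Fin m → α)} (hP : ∀ w ∈ P, ∃ y ∈ F, ∀ t : Fin m, φ (T^[t] y) = w t) :
    (P.card : ℕ∞) ≤ coverMincard T F (fiberRel φ) m := by
  classical
  refine le_iInf₂ fun s hs => Nat.cast_le.2 ?_
  suffices h : P ⊆ s.image fun y (t : Fin m) => φ (T^[t] y) from
    (Finset.card_le_card h).trans Finset.card_image_le
  intro w hw
  obtain ⟨y, hyF, hyw⟩ := hP w hw
  obtain ⟨z, hzs, hyz⟩ := hs hyF
  refine Finset.mem_image.2 ⟨z, hzs, funext fun t => ?_⟩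
  exact (mem_dynEntourage.1 hyz t t.2).symm.trans (hyw t)

lemma card_pathsFrom_le_coverMincard_fiberRel {ι : Type*} [Fintype ι] {R : ι → ι → Prop}
    (hR : ∀ a, ∃ b, R a b) {g : ℕ → ι} (hg : ∀ k, R (g (k + 1)) (g k)) {T : Y → Y} {F : Set Y}
    {φ : Y → α} (e : ι ↪ α)
    (hφ : ∀ x : ℤ → ι, (∀ k, R (x k) (x (k + 1))) → ∃ y ∈ F, ∀ t : ℕ, φ (T^[t] y) = e (x t))
    (m : ℕ) : ((pathsFrom R m (g 0)).card : ℕ∞) ≤ coverMincard T F (fiberRel φ) (m + 1) := by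
  rw [← Finset.card_map e.arrowCongrRight]
  refine card_le_coverMincard_fiberRel (Finset.forall_mem_map.2 fun w hwm => ?_)
  obtain ⟨hw₀, hw⟩ := mem_pathsFrom.1 hwm
  obtain ⟨x, hxw, hx⟩ := exists_nat_path_of_fin_path hR hw
  obtain ⟨x', hx'x, hx'⟩ := exists_int_path_of_nat_paths hx hg ((hxw 0).trans hw₀)
  obtain ⟨y, hyF, hy⟩ := hφ x' hx'
  exact ⟨y, hyF, fun t => by rw [hy, hx'x, hxw]; rfl⟩

open Classical in
theorem log_le_coverEntropyEntourage_fiberRel {ι : Type*} [Fintype ι] [Nonempty ι]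
    {R : ι → ι → Prop} {c : ι → ℝ≥0} {r : ℝ≥0} (hc₀ : ∀ a, c a ≠ 0)
    (hc : ∀ a, r * c a ≤ ∑ b with R a b, c b) {T : Y → Y} {F : Set Y} {φ : Y → α} (e : ι ↪ α)
    (hφ : ∀ x : ℤ → ι, (∀ k, R (x k) (x (k + 1))) → ∃ y ∈ F, ∀ t : ℕ, φ (T^[t] y) = e (x t)) :
    ENNReal.log r ≤ coverEntropyEntourage T F (fiberRel φ) := by
  rcases eq_or_ne r 0 with rfl | hr
  · simp
  have hR (a : ι) : ∃ b, R a b := by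
    have hpos : 0 < ∑ b with R a b, c b :=
      (mul_pos hr.pos (hc₀ a).pos).trans_le (hc a)
    obtain ⟨b, hb, -⟩ := Finset.exists_ne_zero_of_sum_ne_zero hpos.ne'
    exact ⟨b, (Finset.mem_filter.1 hb).2⟩
  obtain ⟨g, hg⟩ := exists_backward_path hR
  refine log_le_expGrowthSup_of_pow_mul_le (C := ∑ a, c a) (hc₀ (g 0)) fun m => ?_
  calc (r : ℝ≥0∞) ^ m * c (g 0)
      ≤ (∑ a, c a : ℝ≥0) * (pathsFrom R m (g 0)).card := by
        exact_mod_cast pow_mul_le_card_pathsFrom hc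
          (fun a => Finset.single_le_sum (fun _ _ => zero_le) (Finset.mem_univ a)) m (g 0)
    _ ≤ (∑ a, c a : ℝ≥0) * coverMincard T F (fiberRel φ) (m + 1) := by
        gcongr
        exact_mod_cast ENat.toENNReal_mono (card_pathsFrom_le_coverMincard_fiberRel hR hg e hφ m)

end Coding

section Matrix

variable {ι : Type*} [Fintype ι]

lemma exists_vecMul_eq_smul_of_mem_spectrum {K : Type*} [Field K] [DecidableEq ι]
    {A : Matrix ι ι K} {μ : K} (hμ : μ ∈ spectrum K A) : ∃ u ≠ 0, u ᵥ* A = μ • u := by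
  have hdet : (algebraMap K (Matrix ι ι K) μ - A).det = 0 := by
    simpa [spectrum.mem_iff, Matrix.isUnit_iff_isUnit_det] using hμ
  obtain ⟨u, hu, huA⟩ := Matrix.exists_vecMul_eq_zero_iff.2 hdet
  refine ⟨u, hu, ?_⟩
  simpa [Matrix.vecMul_sub, sub_eq_zero, Algebra.algebraMap_eq_smul_one, Matrix.vecMul_smul,
    eq_comm] using huA

open Classical in
lemma nnnorm_mul_le_sum_of_vecMul_eq_smul {K : Type*} [NormedField K] {A : Matrix ι ι K}
    (hA : ∀ i j, A i j = 0 ∨ A i j = 1) {u : ι → K} {μ : K} (hu : u ᵥ* A = μ • u) (a : ι) :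
    ‖μ‖₊ * ‖u a‖₊ ≤ ∑ b with A b a = 1, ‖u b‖₊ := by
  calc ‖μ‖₊ * ‖u a‖₊
      = ‖∑ b, u b * A b a‖₊ := by
        rw [← nnnorm_mul]; exact congrArg _ (congrFun hu a).symm
    _ = ‖∑ b with A b a = 1, u b‖₊ := by
        rw [Finset.sum_filter]
        congr! 2 with b
        rcases hA b a with h | h <;> simp [h]
    _ ≤ ∑ b with A b a = 1, ‖u b‖₊ := nnnorm_sum_le ..

theorem log_nnnorm_le_coverEntropyEntourage_fiberRel {K : Type*} [NormedField K]
    {A : Matrix ι ι K} (hA : ∀ i j, A i j = 0 ∨ A i j = 1) {u : ι → K} (hu₀ : u ≠ 0) {μ : K}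
    (hu : u ᵥ* A = μ • u) {Y : Type*} {T : Y → Y} {F : Set Y} {φ : Y → ι}
    (hφ : ∀ x : ℤ → ι, (∀ k, A (x (k + 1)) (x k) = 1) → ∃ y ∈ F, ∀ t : ℕ, φ (T^[t] y) = x t) :
    ENNReal.log ‖μ‖₊ ≤ coverEntropyEntourage T F (fiberRel φ) := by
  classical
  obtain ⟨a₀, ha₀⟩ := ne_iff.1 hu₀
  have : Nonempty {a // u a ≠ 0} := ⟨⟨a₀, ha₀⟩⟩
  refine log_le_coverEntropyEntourage_fiberRel (ι := {a // u a ≠ 0})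
    (R := fun a b => A b a = 1) (c := fun a => ‖u a‖₊)
    (fun a => nnnorm_ne_zero_iff.2 a.2) (fun a => ?_) (.subtype _) fun x hx => hφ (fun k => x k) hx
  calc ‖μ‖₊ * ‖u a‖₊
      ≤ ∑ b with A b a = 1, ‖u b‖₊ := nnnorm_mul_le_sum_of_vecMul_eq_smul hA hu a
    _ = ∑ b with u b ≠ 0, if A b a = 1 then ‖u b‖₊ else 0 := by
        rw [Finset.sum_filter, Finset.sum_filter_of_ne (by simp +contextual)]
    _ = ∑ b : {b // u b ≠ 0}, if A b.1 a = 1 then ‖u b.1‖₊ else 0 :=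
        Finset.sum_subtype _ (by simp) _
    _ = ∑ b : {b // u b ≠ 0} with A b.1 a = 1, ‖u b.1‖₊ := (Finset.sum_filter ..).symm

theorem log_spectralRadius_le_coverEntropyEntourage_fiberRel {K : Type*} [NormedField K]
    [DecidableEq ι] {A : Matrix ι ι K} (hA : ∀ i j, A i j = 0 ∨ A i j = 1)
    {Y : Type*} {T : Y → Y} {F : Set Y} {φ : Y → ι}
    (hφ : ∀ x : ℤ → ι, (∀ k, A (x (k + 1)) (x k) = 1) → ∃ y ∈ F, ∀ t : ℕ, φ (T^[t] y) = x t) :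
    ENNReal.log (spectralRadius K A) ≤ coverEntropyEntourage T F (fiberRel φ) := by
  rw [← ENNReal.logOrderIso_apply, ← OrderIso.le_symm_apply]
  refine iSup₂_le fun μ hμ => ?_
  rw [OrderIso.le_symm_apply, ENNReal.logOrderIso_apply]
  obtain ⟨u, hu₀, hu⟩ := exists_vecMul_eq_smul_of_mem_spectrum hμ
  exact log_nnnorm_le_coverEntropyEntourage_fiberRel hA hu₀ hu hφ

end Matrix

lemma shiftMap_iterate_apply {n : ℕ} (A : Matrix (Fin n) (Fin n) ℂ) (t : ℕ) (x : AdmissibleSeq A)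
    (z : ℤ) : ((shiftMap A)^[t] x).1 z = x.1 (z + t) := by
  induction t generalizing x with
  | zero => simp
  | succ t ih =>
    rw [iterate_succ_apply, ih, Nat.cast_succ, ← add_assoc]
    rfl

theorem lemma5p14_general {X : Type*} [UniformSpace X] {f : X → X} {S : Set X} (hS : IsCompact S)
    (hinv : MapsTo f S S) {n : ℕ} {A : Matrix (Fin n) (Fin n) ℂ}
    (hA : ∀ i j, A i j = 0 ∨ A i j = 1) {π : S → AdmissibleSeq A} (hπ_cont : Continuous π)
    (hπ_surj : Surjective π) (hπ : Semiconj π (hinv.restrict f S S) (shiftMap A)) :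
    ENNReal.log (spectralRadius ℂ A) ≤ coverEntropy f S := by
  have : CompactSpace S := isCompact_iff_compactSpace.1 hS
  have hφ_cont : Continuous fun y => (π y).1 0 :=
    (continuous_apply 0).comp (continuous_subtype_val.comp hπ_cont)
  have hφ (x : ℤ → Fin n) (hx : ∀ k, A (x (k + 1)) (x k) = 1) :
      ∃ y ∈ univ, ∀ t : ℕ, (π ((hinv.restrict f S S)^[t] y)).1 0 = x t := by
    obtain ⟨y, hy⟩ := hπ_surj ⟨x, hx⟩
    refine ⟨y, mem_univ y, fun t => ?_⟩
    rw [(hπ.iterate_right t).eq, hy, shiftMap_iterate_apply, zero_add]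
  calc ENNReal.log (spectralRadius ℂ A)
      ≤ coverEntropyEntourage (hinv.restrict f S S) univ (fiberRel fun y => (π y).1 0) :=
        log_spectralRadius_le_coverEntropyEntourage_fiberRel hA hφ
    _ ≤ coverEntropy (hinv.restrict f S S) univ :=
        coverEntropyEntourage_le_coverEntropy _ _ (fiberRel_mem_uniformity hφ_cont)
    _ = coverEntropy f S := coverEntropy_restrict hinv

theorem lemma5p14 {X : Type*} [UniformSpace X] (f : X → X) (hf : Continuous f)
    (S : Set X) (hS : IsCompact S) (hinv : Set.MapsTo f S S)
    (n : ℕ) (A : Matrix (Fin n) (Fin n) ℂ) (hA : ∀ i j, A i j = 0 ∨ A i j = 1)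
    (π : S → AdmissibleSeq A) (hπ_cont : Continuous π) (hπ_surj : Function.Surjective π)
    (hπ : shiftMap A ∘ π = π ∘ hinv.restrict f S S) :
    ENNReal.log (spectralRadius ℂ A) ≤ topologicalEntropy f :=
  (lemma5p14_general hS hinv hA hπ_cont hπ_surj fun x => (congrFun hπ x).symm).trans
    (le_iSup₂_of_le S hS le_rfl)
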